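/- Let $\mathbb{D}$ be the open unit disc, $\mathbb{T}$ the unit circle with normalized arc-length measure $m$, and $L^2(\mathbb{T})=L^2(\mathbb{T},m)$. Let $H^2$ be the closed subspace of $L^2(\mathbb{T})$ of functions whose negative Fourier coefficients vanish, and let $P_+:L^2(\mathbb{T})\to H^2$ be the orthogonal projection. For $\phi\in L^\infty(\mathbb{T})$ let $T_\phi f=P_+(\phi f)$ be the Toeplitz operator on $H^2$. Let $H^\infty$ be the space of bounded analytic functions on $\mathbb{D}$ with the supremum norm; each $b\in H^\infty$, $b(z)=\sum_{n\ge0}a_nz^n$, is identified on $\mathbb{T}$ with its boundary function $b(\zeta)=\sum_{n\ge 0}a_n\zeta^n\in L^\infty(\mathbb{T})$ (convergence in $L^2(\mathbb{T})$). For $\|b\|_\infty\le 1$ let $$\mathcal{H}(b)=(1-T_bT_{\overline b})^{1/2}H^2,$$ with the norm that makes $(1-T_bT_{\overline b})^{1/2}$ a partial isometry of $H^2$ onto $\mathcal{H}(b)$. **Proposition.** Let $b$ be an extreme point of the closed unit ball of $H^\infty$, let $E=\{\zeta\in\mathbb{T}:|b(\zeta)|<1\}$, and regard $L^2(E)$ as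 the subspace of $L^2(\mathbb{T})$ of functions vanishing a.e. outside $E$. Then for every $f\in\mathcal{H}(b)$ the equation $$P_+(\overline b f)=-P_+\big(\sqrt{1-|b|^2}\,g\big)$$ has a unique solution $g\in L^2(E)$, and the map $J:\mathcal{H}(b)\to H^2\oplus L^2(E)$, $Jf=(f,g)$, is a linear isometry. Moreover, $$J(\mathcal{H}(b))^\perp=\Big\{\big(bh,\sqrt{1-|b|^2}\,h\big):h\in H^2\Big\},$$ the orthogonal complement being taken in the Hilbert space direct sum $H^2\oplus L^2(E)$. -/

import Mathlib

open MeasureTheory Filter Topology AddCircle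
open scoped ENNReal Complex.UnitDisc InnerProductSpace BoundedContinuousFunction

noncomputable section

namespace DBR

/-! ### Positive square roots and range spaces -/

section RangeSpace

variable {H : Type} [NormedAddCommGroup H] [InnerProductSpace ℂ H] [CompleteSpace H]

/-- The positive square root of a positive operator on a Hilbert space. -/
def sqrtOp (S : H →L[ℂ] H) : H →L[ℂ] H := CFC.sqrt S

/-- The range `A H` of an operator `A`, with the norm defined below (not the norm of `H`). -/
def RangeSpace (A : H →L[ℂ] H) : Type := LinearMap.range (A : H →ₗ[ℂ] H)

namespace RangeSpace

variable (A : H →L[ℂ] H)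

instance : AddCommGroup (RangeSpace A) :=
  inferInstanceAs (AddCommGroup (LinearMap.range (A : H →ₗ[ℂ] H)))

instance : Module ℂ (RangeSpace A) :=
  inferInstanceAs (Module ℂ (LinearMap.range (A : H →ₗ[ℂ] H)))

/-- The inclusion of `A H` in `H`. -/
def incl : RangeSpace A →ₗ[ℂ] H := (LinearMap.range (A : H →ₗ[ℂ] H)).subtype

theorem isCompl_ker : IsCompl (LinearMap.ker (A : H →ₗ[ℂ] H))ᗮ (LinearMap.ker (A : H →ₗ[ℂ] H)) :=
  haveI : CompleteSpace (LinearMap.ker (A : H →ₗ[ℂ] H)) := A.isClosed_ker.completeSpace_coe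
  (Submodule.isCompl_orthogonal (K := LinearMap.ker (A : H →ₗ[ℂ] H))).symm

/-- The inverse of the linear bijection that `A` induces from `(ker A)^⊥` onto `A H`. -/
def lift : RangeSpace A ≃ₗ[ℂ] ((LinearMap.ker (A : H →ₗ[ℂ] H))ᗮ : Submodule ℂ H) :=
  (LinearMap.kerComplementEquivRange (A : H →ₗ[ℂ] H) (isCompl_ker A)).symm

/-- The element of `(ker A)^⊥` assigned to `f` is mapped to `f` by `A`. -/
theorem map_lift (f : RangeSpace A) : A (lift A f : H) = incl A f :=
  congrArg Subtype.val
    ((LinearMap.kerComplementEquivRange (A : H →ₗ[ℂ] H) (isCompl_ker A)).apply_symm_apply f)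

/-- The norm of the range space: the one for which `A` is a partial isometry of `H` onto `A H`,
that is, for which `A` maps `(ker A)^⊥` isometrically onto `A H`. -/
instance : NormedAddCommGroup (RangeSpace A) :=
  NormedAddCommGroup.induced (RangeSpace A) _ (lift A).toLinearMap (lift A).injective

instance : InnerProductSpace ℂ (RangeSpace A) where
  toNormedSpace := NormedSpace.induced ℂ (RangeSpace A) _ (lift A).toLinearMap
  inner x y := ⟪lift A x, lift A y⟫_ℂ
  norm_sq_eq_re_inner x := norm_sq_eq_re_inner (𝕜 := ℂ) (lift A x)
  conj_inner_symm x y := inner_conj_symm _ _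
  add_left x y z := by rw [map_add, inner_add_left]
  smul_left x y c := by rw [map_smul, inner_smul_left]

end RangeSpace

end RangeSpace

/-! ### The circle, `L²` and `H²` -/

/-- The circle `𝕋`, parametrized by `t ↦ e^{2πit}`, `t ∈ ℝ/ℤ`; `fourier n t = e^{2πint}` is the
function `ζⁿ`. -/
abbrev T : Type := UnitAddCircle

/-- Normalized arc length measure on the circle. -/
abbrev m : Measure T := haarAddCircle

/-- `L²(𝕋)`. -/
abbrev L2 : Type := Lp ℂ 2 m

/-- `L^∞(𝕋)`. -/
abbrev LInf : Type := Lp ℂ ∞ m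

/-- The Hardy space `H²`: the functions in `L²(𝕋)` whose negative Fourier coefficients vanish. -/
def H2 : Submodule ℂ L2 where
  carrier := {f | ∀ n : ℤ, n < 0 → fourierCoeff f n = 0}
  zero_mem' := fun n _ => by
    rw [← fourierBasis_repr]; simp
  add_mem' := fun {f g} hf hg n hn => by
    have hf' := hf n hn
    have hg' := hg n hn
    rw [← fourierBasis_repr] at hf' hg' ⊢
    simp [hf', hg']
  smul_mem' := fun c f hf n hn => by
    have hf' := hf n hn
    rw [← fourierBasis_repr] at hf' ⊢
    simp [hf']

theorem mem_H2 {f : L2} : f ∈ H2 ↔ ∀ n : ℤ, n < 0 → fourierCoeff f n = 0 := Iff.rfl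

theorem isClosed_H2 : IsClosed (H2 : Set L2) := by
  have h : (H2 : Set L2) =
      ⋂ (n : ℤ) (_ : n < 0), {f : L2 | ⟪(fourierBasis (T := 1)) n, f⟫_ℂ = 0} := by
    ext f
    simp only [SetLike.mem_coe, mem_H2, Set.mem_iInter, Set.mem_ofPred_eq,
      ← HilbertBasis.repr_apply_apply, fourierBasis_repr]
  rw [h]
  refine isClosed_iInter fun n => isClosed_iInter fun _ => ?_
  exact isClosed_eq (by fun_prop) continuous_const

instance : CompleteSpace H2 := isClosed_H2.completeSpace_coe

/-- The orthogonal projection `P₊` of `L²(𝕋)` onto `H²`. -/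
def Pplus : L2 →L[ℂ] H2 := H2.orthogonalProjectionOnto

/-- Multiplication by `φ ∈ L^∞(𝕋)` on `L²(𝕋)`. -/
def mulOp (φ : LInf) : L2 →L[ℂ] L2 := (ContinuousLinearMap.mul ℂ ℂ).holderL m ∞ 2 2 φ

theorem coeFn_mulOp (φ : LInf) (f : L2) : mulOp φ f =ᵐ[m] fun t => φ t * f t :=
  (ContinuousLinearMap.mul ℂ ℂ).coeFn_holder φ f

/-- The Toeplitz operator `T_φ f = P₊(φ f)` on `H²`. -/
def toeplitz (φ : LInf) : H2 →L[ℂ] H2 := Pplus ∘L mulOp φ ∘L H2.subtypeL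

/-- `L²(E)`: the functions in `L²(𝕋)` that vanish a.e. outside `E`. -/
def L2On (E : Set T) : Submodule ℂ L2 where
  carrier := {g | ∀ᵐ t ∂m, t ∉ E → g t = 0}
  zero_mem' := by
    filter_upwards [Lp.coeFn_zero ℂ 2 m] with t ht _
    exact ht
  add_mem' := fun {f g} hf hg => by
    filter_upwards [hf, hg, Lp.coeFn_add f g] with t h1 h2 h3 ht
    rw [h3, Pi.add_apply, h1 ht, h2 ht, add_zero]
  smul_mem' := fun c f hf => by
    filter_upwards [hf, Lp.coeFn_smul c f] with t h1 h3 ht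
    rw [h3, Pi.smul_apply, h1 ht, smul_zero]

/-! ### `H^∞` and boundary values -/

/-- A function on the open unit disc, extended by `0` to the plane. -/
def ext (f : 𝔻 → ℂ) (z : ℂ) : ℂ := if h : ‖z‖ < 1 then f (Complex.UnitDisc.mk z h) else 0

theorem ext_of_lt (f : 𝔻 → ℂ) {z : ℂ} (h : ‖z‖ < 1) :
    ext f z = f (Complex.UnitDisc.mk z h) := dif_pos h

/-- `H^∞`: the bounded analytic functions on the open unit disc, with the supremum norm. -/
def HInf : Submodule ℂ (𝔻 →ᵇ ℂ) where
  carrier := {f | DifferentiableOn ℂ (ext f) (Metric.ball 0 1)}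
  zero_mem' := by
    refine (differentiableOn_const (0 : ℂ)).congr fun z _ => ?_
    simp [ext]
  add_mem' := fun {f g} hf hg => by
    refine (DifferentiableOn.add hf hg).congr fun z hz => ?_
    rw [mem_ball_zero_iff] at hz
    simp [ext_of_lt _ hz]
  smul_mem' := fun c f hf => by
    refine (DifferentiableOn.const_smul hf c).congr fun z hz => ?_
    rw [mem_ball_zero_iff] at hz
    simp [ext_of_lt _ hz]

/-- The `n`-th Taylor coefficient of `b` at the origin. -/
def taylorCoeff (b : HInf) (n : ℕ) : ℂ :=
  (n.factorial : ℂ)⁻¹ * iteratedDeriv n (ext (b : 𝔻 →ᵇ ℂ)) 0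

/-- The monomial `ζⁿ` as an element of `L²(𝕋)`. -/
def mono (n : ℕ) : L2 := fourierLp 2 (n : ℤ)

/-- The boundary function of `b ∈ H^∞` as an element of `L²(𝕋)`: the sum in `L²(𝕋)` of
`∑ aₙ ζⁿ`, where `∑ aₙ zⁿ` is the Taylor series of `b`. -/
def boundary2 (b : HInf) : L2 := ∑' n : ℕ, taylorCoeff b n • mono n

theorem orthonormal_mono : Orthonormal ℂ mono :=
  (orthonormal_fourier (T := 1)).comp (fun n : ℕ => (n : ℤ)) Nat.cast_injective

theorem hasSum_norm_sq {c : ℕ → ℂ} {x : L2} (h : HasSum (fun n => c n • mono n) x) :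
    HasSum (fun n => ‖c n‖ ^ 2) (‖x‖ ^ 2) := by
  have h' : Tendsto (fun s : Finset ℕ => ‖∑ n ∈ s, c n • mono n‖ ^ 2) atTop (𝓝 (‖x‖ ^ 2)) :=
    (Tendsto.norm h).pow 2
  refine h'.congr fun s => ?_
  have := orthonormal_mono.inner_sum c c s
  rw [@norm_sq_eq_re_inner ℂ, this, map_sum]
  refine Finset.sum_congr rfl fun n _ => ?_
  rw [RCLike.conj_mul, ← RCLike.ofReal_pow, RCLike.ofReal_re]

theorem hasSum_ext (b : HInf) {z : ℂ} (hz : ‖z‖ < 1) :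
    HasSum (fun n => taylorCoeff b n * z ^ n) (ext (b : 𝔻 →ᵇ ℂ) z) := by
  have := Complex.hasSum_taylorSeries_on_ball (c := 0) (r := 1) b.2
    (z := z) (by simpa using hz)
  convert! this using 2 with n
  simp only [taylorCoeff, sub_zero, smul_eq_mul]
  ring

theorem norm_ext_le (b : HInf) (z : ℂ) : ‖ext (b : 𝔻 →ᵇ ℂ) z‖ ≤ ‖b‖ := by
  unfold ext
  split_ifs
  · exact (b : 𝔻 →ᵇ ℂ).norm_coe_le_norm _
  · rw [norm_zero]
    exact norm_nonneg b

/-- The dilations of `b`. -/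
theorem exists_dilation (b : HInf) {r : ℝ} (h0 : 0 ≤ r) (h1 : r < 1) :
    ∃ x : L2, HasSum (fun n => (taylorCoeff b n * r ^ n) • mono n) x ∧ ∀ᵐ t ∂m, ‖x t‖ ≤ ‖b‖ := by
  have hs : Summable (fun n : ℕ => (taylorCoeff b n * (r : ℂ) ^ n) • fourier (T := 1) (n : ℤ)) := by
    refine Summable.of_norm ?_
    have h := (hasSum_ext b (z := (r : ℂ)) (by simpa [abs_of_nonneg h0] using h1)).summable.norm
    refine h.congr fun n => ?_
    rw [norm_smul, fourier_norm, mul_one]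
  obtain ⟨f, hf⟩ := hs
  refine ⟨ContinuousMap.toLp 2 m ℂ f, ?_, ?_⟩
  · have := (ContinuousMap.toLp (E := ℂ) 2 m ℂ).hasSum hf
    have he : (fun n => (taylorCoeff b n * (r : ℂ) ^ n) • mono n) = fun n : ℕ =>
        ContinuousMap.toLp (E := ℂ) 2 m ℂ
          ((taylorCoeff b n * (r : ℂ) ^ n) • fourier (T := 1) (n : ℤ)) := by
      funext n
      rw [map_smul]
      rfl
    rw [he]
    exact this
  · filter_upwards [ContinuousMap.coeFn_toLp (p := 2) (𝕜 := ℂ) m f] with t ht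
    rw [ht]
    have h2 := (ContinuousMap.evalCLM ℂ t).hasSum hf
    have hz : ‖(r : ℂ) * fourier (T := 1) 1 t‖ < 1 := by
      rw [norm_mul, fourier_apply, Circle.norm_coe]
      simpa [abs_of_nonneg h0] using h1
    have h3 := hasSum_ext b hz
    have : f t = ext (b : 𝔻 →ᵇ ℂ) ((r : ℂ) * fourier (T := 1) 1 t) := by
      refine h2.unique ?_
      convert! h3 using 2 with n
      simp [fourier_apply, mul_pow, mul_assoc, AddCircle.toCircle_nsmul]
    rw [this]
    exact norm_ext_le b _

theorem summable_taylorCoeff_sq (b : HInf) : Summable (fun n => ‖taylorCoeff b n‖ ^ 2) := by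
  refine summable_of_sum_le (c := ‖b‖ ^ 2) (fun n => sq_nonneg _) fun s => ?_
  have hcont : Tendsto (fun r : ℝ => ∑ n ∈ s, ‖taylorCoeff b n * (r : ℂ) ^ n‖ ^ 2) (𝓝[<] 1)
      (𝓝 (∑ n ∈ s, ‖taylorCoeff b n‖ ^ 2)) := by
    have hc : Continuous (fun r : ℝ => ∑ n ∈ s, ‖taylorCoeff b n * (r : ℂ) ^ n‖ ^ 2) := by
      fun_prop
    simpa using (hc.tendsto 1).mono_left nhdsWithin_le_nhds
  refine le_of_tendsto hcont ?_
  have : Set.Ioo (0 : ℝ) 1 ∈ 𝓝[<] (1 : ℝ) := Ioo_mem_nhdsLT zero_lt_one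
  filter_upwards [this] with r hr
  obtain ⟨x, hx, hxb⟩ := exists_dilation b hr.1.le hr.2
  refine (sum_le_hasSum s (fun n _ => sq_nonneg _) (hasSum_norm_sq hx)).trans ?_
  have h := Lp.norm_le_of_ae_bound (norm_nonneg b) hxb
  have h1 : measureUnivNNReal m = 1 := by simp [measureUnivNNReal]
  rw [h1, NNReal.coe_one, Real.one_rpow, one_mul] at h
  exact pow_le_pow_left₀ (norm_nonneg _) h 2

theorem hasSum_boundary2 (b : HInf) :
    HasSum (fun n => taylorCoeff b n • mono n) (boundary2 b) := by
  refine Summable.hasSum ?_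
  have h := (orthonormal_mono.orthogonalFamily).summable_iff_norm_sq_summable
    (fun n => taylorCoeff b n)
  simpa using h.2 (summable_taylorCoeff_sq b)

/-- The boundary function is bounded a.e. by the supremum norm. -/
theorem boundary2_bound (b : HInf) : ∀ᵐ t ∂m, ‖boundary2 b t‖ ≤ ‖b‖ := by
  obtain ⟨r, -, hr, hrl⟩ := exists_seq_strictMono_tendsto' (zero_lt_one (α := ℝ))
  have hx := fun k => exists_dilation b (hr k).1.le (hr k).2
  choose x hxs hxb using hx
  have hlim : Tendsto x atTop (𝓝 (boundary2 b)) := by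
    rw [tendsto_iff_norm_sub_tendsto_zero]
    have key : ∀ k, ‖x k - boundary2 b‖ ^ 2 =
        ∑' n, ‖taylorCoeff b n * (r k : ℂ) ^ n - taylorCoeff b n‖ ^ 2 := fun k => by
      refine (hasSum_norm_sq ?_).tsum_eq.symm
      simpa only [sub_smul] using (hxs k).sub (hasSum_boundary2 b)
    have h2 : Tendsto (fun k => ‖x k - boundary2 b‖ ^ 2) atTop (𝓝 0) := by
      simp only [key]
      have := tendsto_tsum_of_dominated_convergence (𝓕 := (atTop : Filter ℕ))
        (f := fun k n => ‖taylorCoeff b n * (r k : ℂ) ^ n - taylorCoeff b n‖ ^ 2)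
        (g := fun _ => (0 : ℝ)) (bound := fun n => ‖taylorCoeff b n‖ ^ 2)
        (summable_taylorCoeff_sq b) ?_ ?_
      · simpa using this
      · intro n
        have hc : Continuous (fun s : ℝ => ‖taylorCoeff b n * (s : ℂ) ^ n - taylorCoeff b n‖ ^ 2) := by
          fun_prop
        simpa [Function.comp_def] using (hc.tendsto 1).comp hrl
      · refine Eventually.of_forall fun k n => ?_
        have h0 := (hr k).1.le
        have h1 : r k ^ n ≤ 1 := pow_le_one₀ h0 (hr k).2.le
        have h3 : 0 ≤ r k ^ n := pow_nonneg h0 n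
        have : ‖taylorCoeff b n * (r k : ℂ) ^ n - taylorCoeff b n‖ ≤ ‖taylorCoeff b n‖ := by
          rw [show taylorCoeff b n * (r k : ℂ) ^ n - taylorCoeff b n
            = taylorCoeff b n * ((r k ^ n - 1 : ℝ) : ℂ) by push_cast; ring, norm_mul,
            Complex.norm_real, Real.norm_eq_abs]
          refine mul_le_of_le_one_right (norm_nonneg _) ?_
          rw [abs_le]; constructor <;> linarith
        rw [Real.norm_of_nonneg (by positivity)]
        gcongr
    have h3 := h2.sqrt
    simpa [Real.sqrt_sq] using h3
  obtain ⟨ns, -, hns⟩ := (tendstoInMeasure_of_tendsto_Lp hlim).exists_seq_tendsto_ae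
  have hall : ∀ᵐ t ∂m, ∀ k, ‖x k t‖ ≤ ‖b‖ := ae_all_iff.2 hxb
  filter_upwards [hns, hall] with t ht hb
  exact le_of_tendsto ht.norm (Eventually.of_forall fun k => hb _)

theorem memLp_boundary2 (b : HInf) : MemLp (boundary2 b) ∞ m :=
  memLp_top_of_bound (Lp.aestronglyMeasurable _) ‖b‖ (boundary2_bound b)

/-- The boundary function of `b ∈ H^∞` as an element of `L^∞(𝕋)`. -/
def boundary (b : HInf) : LInf := (memLp_boundary2 b).toLp (boundary2 b)

theorem memLp_defect (b : HInf) :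
    MemLp (fun t => ((Real.sqrt (1 - ‖boundary b t‖ ^ 2) : ℝ) : ℂ)) ∞ m := by
  refine memLp_top_of_bound ?_ 1 (Eventually.of_forall fun t => ?_)
  · have h : AEStronglyMeasurable (boundary b) m := Lp.aestronglyMeasurable _
    have hc : Continuous (fun z : ℂ => ((Real.sqrt (1 - ‖z‖ ^ 2) : ℝ) : ℂ)) := by fun_prop
    exact hc.comp_aestronglyMeasurable h
  · rw [Complex.norm_real, Real.norm_of_nonneg (Real.sqrt_nonneg _)]
    exact Real.sqrt_le_one.2 (by nlinarith [sq_nonneg ‖boundary b t‖])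

/-- The function `√(1 - |b|²)` on the circle. -/
def defect (b : HInf) : LInf := (memLp_defect b).toLp _

/-- The set `E = {ζ ∈ 𝕋 : |b(ζ)| < 1}`. -/
def E (b : HInf) : Set T := {t | ‖boundary b t‖ < 1}

/-! ### The de Branges–Rovnyak space -/

/-- The operator `(1 - T_b T_{b̄})^{1/2}` on `H²`. -/
def A (b : HInf) : H2 →L[ℂ] H2 :=
  sqrtOp (1 - toeplitz (boundary b) ∘L toeplitz (star (boundary b)))

/-- The space `H(b) = (1 - T_b T_{b̄})^{1/2} H²`, with the norm for which
`(1 - T_b T_{b̄})^{1/2}` is a partial isometry of `H²` onto `H(b)`. -/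
abbrev Hb (b : HInf) : Type := RangeSpace (A b)

/-- The inclusion of `H(b)` in `H²`. -/
def Hb.incl (b : HInf) : Hb b →ₗ[ℂ] H2 := RangeSpace.incl (A b)

end DBR

end

noncomputable section

namespace DBR

/-! ### Range spaces of operators with the same defect -/

section RangeSpace

variable {H K : Type} [NormedAddCommGroup H] [InnerProductSpace ℂ H] [CompleteSpace H]
  [NormedAddCommGroup K] [InnerProductSpace ℂ K] [CompleteSpace K]

/-! Write Δ = √(1 - |b|²) and D h = Δh, an operator from H² to L²(E). Since bh stays in H² and |b|²
+ Δ² = 1, the column C h = (T_b h, D h) is an isometry of H² into H² ⊕ L²(E). Let M be the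
orthogonal complement of its range: (f, g) lies in M exactly when T_b* f = -D* g, which is the
equation of the proposition. If R : M → H² is the first coordinate, R* f is the projection of (f, 0)
to M, so R R* = 1 - T_b T_b*. When R is injective, it is therefore a unitary map of M onto the range
space of (R R*)^{1/2}, that is, onto H(b) (`exists_linearIsometry_rangeSpace`). J is its inverse,
and the complement of J(H(b)) = M is the range of C.

Injectivity of R, like uniqueness of g, reduces to injectivity of D*, and only there does
extremality enter (`eq_zero_of_Pplus_mulOp_defect`). If P₊(Δg) = 0, then k, the conjugate of Δg,
lies in H². Choose φ ∈ H² with |φ|²(1 + |g|²) = c > 0 constant. Then q = φk is bounded and |q|² ≤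
c(1 - |b|²) ≤ 2c(1 - |b|), so h = q²/(2c) is in H² and |h| ≤ 1 - |b|. Both b + h and b - h are
boundary functions from the unit ball of H^∞, so h = 0, hence k = 0 and g = 0 on E.

The function φ comes from Szegő's extremal problem for the weight 1 + |g|²
(`exists_mem_H2_norm_sq_mul_eq`), solved by an orthogonal projection in the graph of multiplication
by g. No integrability of logarithms and no outer functions are needed. -/

theorem norm_adjoint_apply_eq {A : H →L[ℂ] H} (hA : IsSelfAdjoint A) {R : K →L[ℂ] H}
    (h : R ∘L R.adjoint = A ∘L A) (v : H) : ‖R.adjoint v‖ = ‖A v‖ := by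
  have h1 := R.adjoint.apply_norm_sq_eq_inner_adjoint_left v
  have h2 := A.apply_norm_sq_eq_inner_adjoint_left v
  rw [ContinuousLinearMap.adjoint_adjoint] at h1
  rw [hA.adjoint_eq] at h2
  have h3 : R (R.adjoint v) = A (A v) := congrArg (fun B : H →L[ℂ] H => B v) h
  simp only [ContinuousLinearMap.comp_apply, h3] at h1 h2
  rw [← h2] at h1
  exact (sq_eq_sq₀ (norm_nonneg _) (norm_nonneg _)).1 h1

/-- Self-adjointness makes (ker A)^⊥ the closure of the range of A. There A v ↦ R* v preserves
norms, so if A vᵢ → u, then R* vᵢ is Cauchy. Its limit is k, and R R* = A² passes to the limit. -/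
theorem exists_preimage_of_mem_ker_orthogonal {A : H →L[ℂ] H} (hA : IsSelfAdjoint A)
    {R : K →L[ℂ] H} (h : R ∘L R.adjoint = A ∘L A) {u : H}
    (hu : u ∈ (LinearMap.ker (A : H →ₗ[ℂ] H))ᗮ) : ∃ k : K, R k = A u ∧ ‖k‖ = ‖u‖ := by
  have hu' : u ∈ closure (Set.range A) := by
    have := A.orthogonal_ker
    rw [hA.adjoint_eq] at this
    rw [this] at hu
    exact hu
  obtain ⟨x, hx, hlim⟩ := mem_closure_iff_seq_limit.1 hu'
  choose v hv using hx
  have hdist : ∀ i j, dist (R.adjoint (v i)) (R.adjoint (v j)) = dist (x i) (x j) := fun i j => by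
    rw [dist_eq_norm, dist_eq_norm, ← map_sub, norm_adjoint_apply_eq hA h, map_sub, hv, hv]
  have hc : CauchySeq (fun i => R.adjoint (v i)) := by
    rw [Metric.cauchySeq_iff]
    intro ε hε
    obtain ⟨N, hN⟩ := Metric.cauchySeq_iff.1 hlim.cauchySeq ε hε
    exact ⟨N, fun i hi j hj => by rw [hdist]; exact hN i hi j hj⟩
  obtain ⟨k, hk⟩ := cauchySeq_tendsto_of_complete hc
  refine ⟨k, ?_, ?_⟩
  · refine tendsto_nhds_unique ((R.continuous.tendsto k).comp hk) ?_
    refine ((A.continuous.tendsto u).comp hlim).congr fun i => ?_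
    have h3 : R (R.adjoint (v i)) = A (A (v i)) := congrArg (fun B : H →L[ℂ] H => B (v i)) h
    simp only [Function.comp_apply, h3, hv]
  · refine tendsto_nhds_unique hk.norm (hlim.norm.congr fun i => ?_)
    rw [norm_adjoint_apply_eq hA h, hv]

/-- If `A` is self-adjoint and `R R* = A²` with `R` injective, then `R` is a unitary operator onto
the range space of `A`. -/
theorem exists_linearIsometry_rangeSpace {A : H →L[ℂ] H} (hA : IsSelfAdjoint A)
    {R : K →L[ℂ] H} (hR : Function.Injective R) (h : R ∘L R.adjoint = A ∘L A) :
    ∃ J : RangeSpace A →ₗᵢ[ℂ] K, (∀ f, R (J f) = RangeSpace.incl A f) ∧ Function.Surjective J := by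
  have key : ∀ f : RangeSpace A, ∃ k : K, R k = RangeSpace.incl A f ∧ ‖k‖ = ‖f‖ := fun f => by
    obtain ⟨k, hk, hk'⟩ := exists_preimage_of_mem_ker_orthogonal hA h (RangeSpace.lift A f).2
    exact ⟨k, hk.trans (RangeSpace.map_lift A f), hk'⟩
  choose j hj hj' using key
  let J : RangeSpace A →ₗᵢ[ℂ] K :=
    { toFun := j
      map_add' := fun x y => hR (by rw [map_add, hj, hj, hj, map_add])
      map_smul' := fun c x => hR (by rw [map_smul, hj, hj, map_smul]; rfl)
      norm_map' := hj' }
  refine ⟨J, hj, fun k => ?_⟩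
  -- Surjectivity runs the same isometry backwards: R is injective, so R* has dense range, and R* vᵢ
  -- → k makes A vᵢ converge to some u. The preimage of k is A u.
  have hdense : k ∈ closure (Set.range R.adjoint) := by
    have := R.orthogonal_ker
    rw [LinearMap.ker_eq_bot.2 hR, Submodule.bot_orthogonal_eq_top] at this
    have hk : k ∈ (⊤ : Submodule ℂ K) := trivial
    rw [this] at hk
    exact hk
  obtain ⟨x, hx, hlim⟩ := mem_closure_iff_seq_limit.1 hdense
  choose v hv using hx
  have hdist : ∀ i l, dist (A (v i)) (A (v l)) = dist (x i) (x l) := fun i l => by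
    rw [dist_eq_norm, dist_eq_norm, ← map_sub, ← norm_adjoint_apply_eq hA h, map_sub, hv, hv]
  have hc : CauchySeq (fun i => A (v i)) := by
    rw [Metric.cauchySeq_iff]
    intro ε hε
    obtain ⟨N, hN⟩ := Metric.cauchySeq_iff.1 hlim.cauchySeq ε hε
    exact ⟨N, fun i hi j hj => by rw [hdist]; exact hN i hi j hj⟩
  obtain ⟨u, hu⟩ := cauchySeq_tendsto_of_complete hc
  refine ⟨(⟨A u, ⟨u, rfl⟩⟩ : LinearMap.range (A : H →ₗ[ℂ] H)), hR ?_⟩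
  refine (hj _).trans ?_
  refine tendsto_nhds_unique ((A.continuous.tendsto u).comp hu) ?_
  refine ((R.continuous.tendsto k).comp hlim).congr fun i => ?_
  have h3 : R (R.adjoint (v i)) = A (A (v i)) := congrArg (fun B : H →L[ℂ] H => B (v i)) h
  simp only [Function.comp_apply, ← hv, h3]

/-! ### Column isometries -/

variable {P : H →L[ℂ] H} {D : H →L[ℂ] K}

/-- The column operator `h ↦ (P h, D h)`, an isometry if `P* P + D* D = 1`. -/
def column (h : ∀ x, ‖P x‖ ^ 2 + ‖D x‖ ^ 2 = ‖x‖ ^ 2) : H →ₗᵢ[ℂ] WithLp 2 (H × K) where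
  toFun x := WithLp.toLp 2 (P x, D x)
  map_add' x y := by rw [map_add, map_add]; rfl
  map_smul' c x := by rw [map_smul, map_smul]; rfl
  norm_map' x := by
    rw [← sq_eq_sq₀ (norm_nonneg _) (norm_nonneg _)]
    exact (WithLp.prod_norm_sq_eq_of_L2 _).trans (h x)

theorem inner_column (h : ∀ x, ‖P x‖ ^ 2 + ‖D x‖ ^ 2 = ‖x‖ ^ 2) (x : H) (y : WithLp 2 (H × K)) :
    ⟪column h x, y⟫_ℂ = ⟪x, P.adjoint y.fst + D.adjoint y.snd⟫_ℂ := by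
  rw [WithLp.prod_inner_apply, inner_add_right, ContinuousLinearMap.adjoint_inner_right,
    ContinuousLinearMap.adjoint_inner_right]
  rfl

/-- The adjoint of the column sends y to P* y.fst + D* y.snd, and the complement of a range is the
kernel of the adjoint. For P = T_b this is the equation that defines g. -/
theorem mem_orthogonal_range_column (h : ∀ x, ‖P x‖ ^ 2 + ‖D x‖ ^ 2 = ‖x‖ ^ 2)
    {y : WithLp 2 (H × K)} : y ∈ (LinearMap.range (column h).toLinearMap)ᗮ ↔
      P.adjoint y.fst = -D.adjoint y.snd := by
  rw [eq_neg_iff_add_eq_zero]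
  constructor
  · intro hy
    refine ext_inner_left ℂ fun x => ?_
    rw [← inner_column h, inner_zero_right]
    exact hy _ ⟨x, rfl⟩
  · rintro hy _ ⟨x, rfl⟩
    refine (inner_column h x y).trans ?_
    rw [hy, inner_zero_right]

set_option linter.unusedSectionVars false in
theorem orthogonal_orthogonal_range_column (h : ∀ x, ‖P x‖ ^ 2 + ‖D x‖ ^ 2 = ‖x‖ ^ 2) :
    (LinearMap.range (column h).toLinearMap)ᗮᗮ = LinearMap.range (column h).toLinearMap := by
  have : CompleteSpace (LinearMap.range (column h).toLinearMap) :=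
    (column h).isometry.isUniformInducing.isComplete_range.completeSpace_coe
  exact Submodule.orthogonal_orthogonal _

/-- The projection of the complement of the range of a column isometry to the first component. -/
def complementFst (h : ∀ x, ‖P x‖ ^ 2 + ‖D x‖ ^ 2 = ‖x‖ ^ 2) :
    ((LinearMap.range (column h).toLinearMap)ᗮ : Submodule ℂ (WithLp 2 (H × K))) →L[ℂ] H :=
  WithLp.fstL 2 ℂ H K ∘L (LinearMap.range (column h).toLinearMap)ᗮ.subtypeL

/-- For an isometry C, the projection onto its range is C C*, and C*(f, 0) = P* f; the difference is
thus the projection of (f, 0) to the complement. -/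
theorem sub_column_mem (h : ∀ x, ‖P x‖ ^ 2 + ‖D x‖ ^ 2 = ‖x‖ ^ 2) (f : H) :
    WithLp.toLp 2 (f, 0) - column h (P.adjoint f) ∈
      (LinearMap.range (column h).toLinearMap)ᗮ := by
  rintro _ ⟨x, rfl⟩
  change ⟪column h x, _⟫_ℂ = 0
  rw [inner_sub_right, LinearIsometry.inner_map_map, inner_column, sub_eq_zero]
  simp

theorem adjoint_complementFst_apply (h : ∀ x, ‖P x‖ ^ 2 + ‖D x‖ ^ 2 = ‖x‖ ^ 2) (f : H) :
    (complementFst h).adjoint f = ⟨_, sub_column_mem h f⟩ := by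
  refine ext_inner_right ℂ fun y => ?_
  rw [ContinuousLinearMap.adjoint_inner_left, Submodule.coe_inner, inner_sub_left]
  have hy : ⟪column h (P.adjoint f), (y : WithLp 2 (H × K))⟫_ℂ = 0 := y.2 _ ⟨_, rfl⟩
  rw [hy, sub_zero, WithLp.prod_inner_apply]
  change _ = ⟪f, (y : WithLp 2 (H × K)).fst⟫_ℂ + ⟪(0 : K), (y : WithLp 2 (H × K)).snd⟫_ℂ
  rw [inner_zero_left, add_zero]
  rfl

/-- This factorization links the complement of the column to the range space of (1 - P P*)^{1/2},
and it also shows that 1 - P P* is positive. -/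
theorem complementFst_comp_adjoint (h : ∀ x, ‖P x‖ ^ 2 + ‖D x‖ ^ 2 = ‖x‖ ^ 2) :
    complementFst h ∘L (complementFst h).adjoint = 1 - P ∘L P.adjoint := by
  ext1 f
  rw [ContinuousLinearMap.comp_apply, adjoint_complementFst_apply]
  rfl

theorem isSelfAdjoint_sqrtOp (S : H →L[ℂ] H) : IsSelfAdjoint (sqrtOp S) :=
  ((ContinuousLinearMap.nonneg_iff_isPositive _).1 (CFC.sqrt_nonneg S)).isSelfAdjoint

theorem sqrtOp_comp_self {S : H →L[ℂ] H} (hS : 0 ≤ S) : sqrtOp S ∘L sqrtOp S = S :=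
  CFC.sqrt_mul_sqrt_self S hS

/-- In the complement, the first coordinate determines D* of the second. -/
theorem complementFst_injective (h : ∀ x, ‖P x‖ ^ 2 + ‖D x‖ ^ 2 = ‖x‖ ^ 2)
    (hD : Function.Injective D.adjoint) : Function.Injective (complementFst h) := fun x y hxy => by
  have hfst : (x : WithLp 2 (H × K)).fst = (y : WithLp 2 (H × K)).fst := hxy
  have hx := (mem_orthogonal_range_column h).1 x.2
  have hy := (mem_orthogonal_range_column h).1 y.2
  rw [hfst, hy, neg_inj] at hx
  exact Subtype.ext (WithLp.ofLp_injective 2 (Prod.ext hfst (hD hx.symm)))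

/-- The range space of `(1 - P P*)^{1/2}` as the complement of the range of `h ↦ (P h, D h)`,
where `P* P + D* D = 1`. -/
theorem exists_linearIsometry_rangeSpace_sqrtOp (h : ∀ x, ‖P x‖ ^ 2 + ‖D x‖ ^ 2 = ‖x‖ ^ 2)
    (hD : Function.Injective D.adjoint) {A : H →L[ℂ] H} (hA : A = sqrtOp (1 - P ∘L P.adjoint)) :
    ∃ J : RangeSpace A →ₗᵢ[ℂ] WithLp 2 (H × K),
      (∀ f, (J f).fst = RangeSpace.incl _ f ∧
        P.adjoint (RangeSpace.incl _ f) = -D.adjoint (J f).snd) ∧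
      ∀ y, y ∈ (LinearMap.range J.toLinearMap)ᗮ ↔ ∃ x, WithLp.toLp 2 (P x, D x) = y := by
  subst hA
  -- Without positivity `sqrtOp` need not square to its argument.
  have hpos : 0 ≤ 1 - P ∘L P.adjoint := by
    rw [← complementFst_comp_adjoint h, ContinuousLinearMap.nonneg_iff_isPositive]
    exact ContinuousLinearMap.isPositive_self_comp_adjoint _
  obtain ⟨J₀, hJ₀, hsurj⟩ := exists_linearIsometry_rangeSpace
    (isSelfAdjoint_sqrtOp (1 - P ∘L P.adjoint)) (complementFst_injective h hD)
    ((complementFst_comp_adjoint h).trans (sqrtOp_comp_self hpos).symm)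
  refine ⟨(LinearMap.range (column h).toLinearMap)ᗮ.subtypeₗᵢ.comp J₀, fun f => ⟨hJ₀ f, ?_⟩, ?_⟩
  · rw [← hJ₀ f]
    exact (mem_orthogonal_range_column h).1 (J₀ f).2
  · have hrange : LinearMap.range
        ((LinearMap.range (column h).toLinearMap)ᗮ.subtypeₗᵢ.comp J₀).toLinearMap =
        (LinearMap.range (column h).toLinearMap)ᗮ := by
      ext x
      constructor
      · rintro ⟨f, rfl⟩
        exact (J₀ f).2
      · intro hx
        obtain ⟨f, hf⟩ := hsurj ⟨x, hx⟩
        exact ⟨f, congrArg Subtype.val hf⟩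
    intro y
    rw [hrange, orthogonal_orthogonal_range_column]
    exact Iff.rfl

end RangeSpace

/-! ### Fourier coefficients and multiplication operators -/

theorem inner_fourierLp (f : L2) (n : ℤ) :
    ⟪(fourierLp 2 n : L2), f⟫_ℂ = fourierCoeff f n := by
  rw [← fourierBasis_repr, HilbertBasis.repr_apply_apply, coe_fourierBasis]

theorem inner_mono (f : L2) (n : ℕ) : ⟪mono n, f⟫_ℂ = fourierCoeff f (n : ℤ) :=
  inner_fourierLp f n

theorem exists_LInf_of_ae_bound {f : L2} {C : ℝ} (h : ∀ᵐ t ∂m, ‖f t‖ ≤ C) :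
    ∃ φ : LInf, φ =ᵐ[m] f :=
  ⟨(memLp_top_of_bound (Lp.aestronglyMeasurable f) C h).toLp f, MemLp.coeFn_toLp _⟩

theorem fourierCoeff_mulOp_fourierLp (φ : LInf) (n k : ℤ) :
    fourierCoeff (mulOp φ (fourierLp 2 n)) k = fourierCoeff φ (k - n) := by
  refine integral_congr_ae ?_
  filter_upwards [coeFn_mulOp φ (fourierLp 2 n), coeFn_fourierLp (T := 1) 2 n] with t h1 h2
  rw [h1, h2, show -(k - n) = -k + n by ring, fourier_add, smul_eq_mul, smul_eq_mul]
  ring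

theorem mem_H2_of_hasSum {ι : Type*} {x : ι → L2} {f : L2} (h : HasSum x f) (hx : ∀ i, x i ∈ H2) :
    f ∈ H2 :=
  isClosed_H2.mem_of_tendsto h (Eventually.of_forall fun _ => H2.sum_mem fun i _ => hx i)

theorem fourierCoeff_fourierLp (n k : ℤ) :
    fourierCoeff (fourierLp 2 n : L2) k = if k = n then 1 else 0 := by
  rw [← inner_fourierLp, orthonormal_iff_ite.1 (orthonormal_fourier (T := 1))]

theorem mono_mem_H2 (n : ℕ) : mono n ∈ H2 := fun k hk => by
  refine (fourierCoeff_fourierLp n k).trans (if_neg ?_)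
  omega

theorem hasSum_of_mem_H2 {f : L2} (hf : f ∈ H2) :
    HasSum (fun n : ℕ => fourierCoeff f (n : ℤ) • mono n) f := by
  have h := hasSum_fourier_series_L2 f
  refine (Function.Injective.hasSum_iff (f := fun n : ℤ => fourierCoeff f n • (fourierLp 2 n : L2))
    (Nat.cast_injective (R := ℤ)) fun n hn => ?_).2 h
  have : n < 0 := by
    by_contra hn'
    exact hn ⟨n.toNat, Int.toNat_of_nonneg (not_lt.1 hn')⟩
  simp only [hf n this, zero_smul]

/-- Each φ ζⁿ with n ≥ 0 has spectrum in [n, ∞); expanding f in the ζⁿ and using that H² is closed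
gives the rest. -/
theorem mulOp_mem_H2 {φ : LInf} (hφ : ∀ n : ℤ, n < 0 → fourierCoeff φ n = 0) {f : L2}
    (hf : f ∈ H2) : mulOp φ f ∈ H2 := by
  refine mem_H2_of_hasSum ((mulOp φ).hasSum (hasSum_of_mem_H2 hf)) fun n => ?_
  rw [map_smul]
  refine H2.smul_mem _ fun k hk => ?_
  exact (fourierCoeff_mulOp_fourierLp φ n k).trans (hφ _ (by omega))

theorem mulOp_mem_H2_of_ae_eq {φ : LInf} {g : L2} (hg : g ∈ H2) (h : φ =ᵐ[m] g) {f : L2}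
    (hf : f ∈ H2) : mulOp φ f ∈ H2 :=
  mulOp_mem_H2 (fun n hn => by rw [fourierCoeff_congr_ae h]; exact hg n hn) hf

theorem inner_mulOp (φ : LInf) (f g : L2) : ⟪mulOp φ f, g⟫_ℂ = ⟪f, mulOp (star φ) g⟫_ℂ := by
  rw [L2.inner_def, L2.inner_def]
  refine integral_congr_ae ?_
  filter_upwards [coeFn_mulOp φ f, coeFn_mulOp (star φ) g, Lp.coeFn_star φ] with t h1 h2 h3
  rw [h1, h2, h3]
  simp only [RCLike.inner_apply, map_mul, Pi.star_apply, RCLike.star_def]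
  ring

theorem adjoint_mulOp (φ : LInf) : (mulOp φ).adjoint = mulOp (star φ) :=
  ((ContinuousLinearMap.eq_adjoint_iff _ _).2 fun x y => by
    rw [← inner_conj_symm, ← inner_mulOp, inner_conj_symm]).symm

theorem adjoint_toeplitz (φ : LInf) : (toeplitz φ).adjoint = toeplitz (star φ) := by
  unfold toeplitz Pplus
  rw [ContinuousLinearMap.adjoint_comp, ContinuousLinearMap.adjoint_comp, adjoint_mulOp,
    Submodule.adjoint_orthogonalProjectionOnto, Submodule.adjoint_subtypeL]
  rfl

theorem Pplus_eq_zero_iff {f : L2} : Pplus f = 0 ↔ f ∈ H2ᗮ :=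
  Submodule.orthogonalProjectionOnto_eq_zero_iff

theorem fourierCoeff_star (f : L2) (n : ℤ) :
    fourierCoeff (star f : L2) n = starRingEnd ℂ (fourierCoeff f (-n)) := by
  rw [fourierCoeff, fourierCoeff, ← integral_conj]
  refine integral_congr_ae ?_
  filter_upwards [Lp.coeFn_star f] with t h
  rw [h, smul_eq_mul, smul_eq_mul, map_mul, ← fourier_neg, neg_neg, fourier_neg, ← fourier_neg]
  rfl

/-- The conjugate of a function orthogonal to `H²` belongs to `H²`. -/
theorem star_mem_H2 {f : L2} (hf : f ∈ H2ᗮ) : star f ∈ H2 := fun n hn => by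
  rw [fourierCoeff_star]
  have h := hf (mono (-n).toNat) (mono_mem_H2 _)
  rw [inner_mono, Int.toNat_of_nonneg (by omega)] at h
  rw [h, map_zero]

/-! ### Boundary functions -/

theorem boundary2_mem_H2 (b : HInf) : boundary2 b ∈ H2 :=
  mem_H2_of_hasSum (hasSum_boundary2 b) fun n => H2.smul_mem _ (mono_mem_H2 n)

theorem coeFn_boundary (b : HInf) : boundary b =ᵐ[m] boundary2 b := MemLp.coeFn_toLp _

theorem coeFn_defect (b : HInf) :
    defect b =ᵐ[m] fun t => ((Real.sqrt (1 - ‖boundary b t‖ ^ 2) : ℝ) : ℂ) := MemLp.coeFn_toLp _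

theorem fourierCoeff_boundary2 (b : HInf) (n : ℕ) :
    fourierCoeff (boundary2 b) (n : ℤ) = taylorCoeff b n := by
  rw [← inner_mono]
  refine ((hasSum_boundary2 b).mapL (innerSL ℂ (mono n))).unique ?_
  convert! hasSum_ite_eq n (taylorCoeff b n) using 2 with k
  rw [innerSL_apply_apply, inner_smul_right, orthonormal_iff_ite.1 orthonormal_mono]
  rcases eq_or_ne k n with rfl | h
  · simp
  · simp [h, h.symm]

theorem eq_of_hasSum_pow {a c : ℕ → ℂ} {F : ℂ → ℂ}
    (ha : ∀ z : ℂ, ‖z‖ < 1 → HasSum (fun n => a n * z ^ n) (F z))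
    (hc : ∀ z : ℂ, ‖z‖ < 1 → HasSum (fun n => c n * z ^ n) (F z)) : a = c := by
  have key : ∀ d : ℕ → ℂ, (∀ z : ℂ, ‖z‖ < 1 → HasSum (fun n => d n * z ^ n) (F z)) →
      HasFPowerSeriesAt F (FormalMultilinearSeries.ofScalars ℂ d) 0 := fun d hd => by
    rw [hasFPowerSeriesAt_iff]
    filter_upwards [Metric.ball_mem_nhds (0 : ℂ) one_pos] with z hz
    rw [zero_add]
    convert! hd z (by simpa using hz) using 2 with n
    rw [FormalMultilinearSeries.coeff_ofScalars, smul_eq_mul, mul_comm]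
  have h := (key a ha).eq_formalMultilinearSeries (key c hc)
  funext n
  rw [← FormalMultilinearSeries.coeff_ofScalars (𝕜 := ℂ) (p := a) (n := n), h,
    FormalMultilinearSeries.coeff_ofScalars]

/-! ### Analytic extension of bounded functions in `H²` -/

/-- The reproducing kernel of `H²` at a point of the disc. -/
theorem exists_kernel {z : ℂ} (hz : ‖z‖ < 1) :
    ∃ k : L2, HasSum (fun n : ℕ => (starRingEnd ℂ z) ^ n • mono n) k := by
  have : Summable (fun n : ℕ => (starRingEnd ℂ z) ^ n • mono n) := by
    refine Summable.of_norm ?_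
    refine (summable_geometric_of_lt_one (norm_nonneg z) hz).congr fun n => ?_
    rw [norm_smul, orthonormal_mono.1 n, mul_one, norm_pow, RCLike.norm_conj]
  exact this

theorem hasSum_inner_kernel {z : ℂ} {k : L2}
    (hk : HasSum (fun n : ℕ => (starRingEnd ℂ z) ^ n • mono n) k) (x : L2) :
    HasSum (fun n : ℕ => fourierCoeff x (n : ℤ) * z ^ n) ⟪k, x⟫_ℂ := by
  have h := Complex.hasSum_conj'.2 (hk.mapL (innerSL ℂ x))
  simp only [innerSL_apply_apply, inner_conj_symm] at h
  convert! h using 2 with n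
  rw [inner_smul_left, inner_mono, map_pow, RCLike.conj_conj, mul_comm]

theorem inner_kernel_mono {z : ℂ} {k : L2}
    (hk : HasSum (fun n : ℕ => (starRingEnd ℂ z) ^ n • mono n) k) (n : ℕ) :
    ⟪k, mono n⟫_ℂ = z ^ n := by
  refine (hasSum_inner_kernel hk (mono n)).unique ?_
  convert! hasSum_ite_eq n (z ^ n) using 2 with j
  rw [mono, fourierCoeff_fourierLp]
  rcases eq_or_ne j n with rfl | hn <;> simp [*]

theorem fourierCoeff_mulOp_mono {φ : LInf} {f : L2} (h : φ =ᵐ[m] f) (n k : ℕ) :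
    fourierCoeff (mulOp φ (mono n)) (k : ℤ) = fourierCoeff f ((k : ℤ) - n) :=
  (fourierCoeff_mulOp_fourierLp φ n k).trans (congrFun (fourierCoeff_congr_ae h) _)

/-- Pairing with the kernel is evaluation at z, so this says that ζⁿ f takes the value zⁿ f(z). On
coefficients, multiplication by ζⁿ is a shift by n. -/
theorem inner_kernel_mulOp_mono {z : ℂ} {k : L2}
    (hk : HasSum (fun n : ℕ => (starRingEnd ℂ z) ^ n • mono n) k) {φ : LInf} {f : L2}
    (hf : f ∈ H2) (h : φ =ᵐ[m] f) (n : ℕ) :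
    ⟪k, mulOp φ (mono n)⟫_ℂ = z ^ n * ⟪k, f⟫_ℂ := by
  have h1 := hasSum_inner_kernel hk (mulOp φ (mono n))
  have h2 := (hasSum_inner_kernel hk f).mul_left (z ^ n)
  have h3 : HasSum (fun j : ℕ => fourierCoeff (mulOp φ (mono n)) ((j + n : ℕ) : ℤ) * z ^ (j + n))
      (z ^ n * ⟪k, f⟫_ℂ) := by
    convert! h2 using 2 with j
    rw [fourierCoeff_mulOp_mono h, pow_add]
    push_cast
    rw [add_sub_cancel_right]
    ring
  refine h1.unique (((add_left_injective n).hasSum_iff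
    (f := fun j : ℕ => fourierCoeff (mulOp φ (mono n)) (j : ℤ) * z ^ j) fun j hj => ?_).1 h3)
  -- The indices missed by j ↦ j + n carry negative Fourier coefficients of f, which vanish.
  have hjn : j < n := by
    by_contra hjn
    exact hj ⟨j - n, Nat.sub_add_cancel (not_lt.1 hjn)⟩
  rw [fourierCoeff_mulOp_mono h, hf _ (by omega), zero_mul]

/-- Expand the right-hand k in powers of ζ; every term of φk contributes the same factor f(z). -/
theorem inner_kernel_mulOp_kernel {z : ℂ} {k : L2}
    (hk : HasSum (fun n : ℕ => (starRingEnd ℂ z) ^ n • mono n) k) {φ : LInf} {f : L2}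
    (hf : f ∈ H2) (h : φ =ᵐ[m] f) : ⟪k, mulOp φ k⟫_ℂ = ⟪k, f⟫_ℂ * ⟪k, k⟫_ℂ := by
  have h1 := (hk.mapL (mulOp φ)).mapL (innerSL ℂ k)
  have h2 := (hk.mapL (innerSL ℂ k)).mul_left ⟪k, f⟫_ℂ
  refine h1.unique ?_
  convert! h2 using 2 with n
  simp only [map_smul, innerSL_apply_apply, smul_eq_mul, inner_kernel_mulOp_mono hk hf h,
    inner_kernel_mono hk]
  ring

/-- A maximum principle without Poisson integrals: f(z)‖k‖² = ⟨k, fk⟩ is at most C‖k‖² in modulus,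
and k ≠ 0. -/
theorem norm_inner_kernel_le {z : ℂ} {k : L2}
    (hk : HasSum (fun n : ℕ => (starRingEnd ℂ z) ^ n • mono n) k) {f : L2}
    (hf : f ∈ H2) {C : ℝ} (hC : ∀ᵐ t ∂m, ‖f t‖ ≤ C) : ‖⟪k, f⟫_ℂ‖ ≤ C := by
  obtain ⟨φ, hφ⟩ := exists_LInf_of_ae_bound hC
  have hk0 : 0 < ‖k‖ := by
    rw [norm_pos_iff]
    rintro rfl
    have h := inner_kernel_mono hk 0
    rw [inner_zero_left, pow_zero] at h
    exact zero_ne_one h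
  have h1 : ‖mulOp φ k‖ ≤ C * ‖k‖ := by
    refine Lp.norm_le_mul_norm_of_ae_le_mul ?_
    filter_upwards [coeFn_mulOp φ k, hφ, hC] with t h1 h2 h3
    rw [h1, norm_mul, h2]
    gcongr
  have h2 := norm_inner_le_norm (𝕜 := ℂ) k (mulOp φ k)
  rw [inner_kernel_mulOp_kernel hk hf hφ, norm_mul, inner_self_eq_norm_sq_to_K, norm_pow,
    RCLike.norm_ofReal, abs_norm, sq] at h2
  have h3 : ‖⟪k, f⟫_ℂ‖ * (‖k‖ * ‖k‖) ≤ C * (‖k‖ * ‖k‖) :=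
    h2.trans ((mul_le_mul_of_nonneg_left h1 hk0.le).trans (by ring_nf; rfl))
  exact le_of_mul_le_mul_right h3 (by positivity)

theorem norm_fourierCoeff_le (f : L2) (n : ℤ) : ‖fourierCoeff f n‖ ≤ ‖f‖ := by
  rw [← inner_fourierLp]
  refine (norm_inner_le_norm _ _).trans ?_
  rw [(orthonormal_fourier (T := 1)).1 n, one_mul]

theorem differentiableOn_tsum_pow {a : ℕ → ℂ} {M : ℝ} (ha : ∀ n, ‖a n‖ ≤ M) :
    DifferentiableOn ℂ (fun z => ∑' n, a n * z ^ n) (Metric.ball 0 1) := fun z hz => by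
  rw [mem_ball_zero_iff] at hz
  obtain ⟨r, hr, hr1⟩ := exists_between hz
  have hr0 : 0 ≤ r := (norm_nonneg z).trans hr.le
  have hd : DifferentiableOn ℂ (fun z => ∑' n, a n * z ^ n) (Metric.ball 0 r) := by
    refine Complex.differentiableOn_tsum_of_summable_norm (u := fun n => M * r ^ n)
      ((summable_geometric_of_lt_one hr0 hr1).mul_left M) (fun n => by fun_prop)
      Metric.isOpen_ball fun n w hw => ?_
    rw [mem_ball_zero_iff] at hw
    rw [norm_mul, norm_pow]
    have := ha n
    have hM : 0 ≤ M := (norm_nonneg _).trans this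
    gcongr
  exact (hd.differentiableAt
    (Metric.isOpen_ball.mem_nhds (mem_ball_zero_iff.2 hr))).differentiableWithinAt

/-- A function in `H²` that is bounded on the circle is the boundary function of a function in
`H^∞` with the same bound. -/
theorem exists_hInf_of_bound {f : L2} (hf : f ∈ H2) {C : ℝ} (hC : ∀ᵐ t ∂m, ‖f t‖ ≤ C) :
    ∃ B : HInf, ‖B‖ ≤ C ∧ boundary2 B = f := by
  let F : ℂ → ℂ := fun z => ∑' n : ℕ, fourierCoeff f (n : ℤ) * z ^ n
  have hsum : ∀ z : ℂ, ‖z‖ < 1 →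
      HasSum (fun n : ℕ => fourierCoeff f (n : ℤ) * z ^ n) (F z) := fun z hz => by
    obtain ⟨k, hk⟩ := exists_kernel hz
    exact (hasSum_inner_kernel hk f).summable.hasSum
  have hbound : ∀ z : ℂ, ‖z‖ < 1 → ‖F z‖ ≤ C := fun z hz => by
    obtain ⟨k, hk⟩ := exists_kernel hz
    rw [(hsum z hz).unique (hasSum_inner_kernel hk f)]
    exact norm_inner_kernel_le hk hf hC
  have hdiff : DifferentiableOn ℂ F (Metric.ball 0 1) :=
    differentiableOn_tsum_pow fun n => norm_fourierCoeff_le f n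
  have hC0 : 0 ≤ C := (norm_nonneg _).trans (hbound 0 (by simp))
  have hcont : Continuous fun z : 𝔻 => F z :=
    hdiff.continuousOn.comp_continuous Complex.UnitDisc.continuous_coe
      fun z => mem_ball_zero_iff.2 z.norm_lt_one
  let B0 : 𝔻 →ᵇ ℂ := BoundedContinuousFunction.ofNormedAddCommGroup (fun z : 𝔻 => F z) hcont C
    fun z => hbound z z.norm_lt_one
  have hext : ∀ z : ℂ, ‖z‖ < 1 → ext B0 z = F z := fun z hz => ext_of_lt _ hz
  let B : HInf := ⟨B0, hdiff.congr fun z hz => hext z (mem_ball_zero_iff.1 hz)⟩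
  have hB : taylorCoeff B = fun n : ℕ => fourierCoeff f (n : ℤ) := by
    refine eq_of_hasSum_pow (F := F) (fun z hz => ?_) hsum
    rw [← hext z hz]
    exact hasSum_ext B hz
  refine ⟨B, (BoundedContinuousFunction.norm_le hC0).2 fun z => hbound z z.norm_lt_one, ?_⟩
  refine (hasSum_boundary2 B).unique ?_
  rw [hB]
  exact hasSum_of_mem_H2 hf

/-- No nonzero `h ∈ H²` satisfies `|h| ≤ 1 - |b|` if `b` is an extreme point. -/
theorem eq_zero_of_extremePoint {b : HInf}
    (hb : b ∈ Set.extremePoints ℝ (Metric.closedBall (0 : HInf) 1)) {h : L2} (hh : h ∈ H2)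
    (hle : ∀ᵐ t ∂m, ‖h t‖ ≤ 1 - ‖boundary b t‖) : h = 0 := by
  have hbd : ∀ᵐ t ∂m, ‖boundary2 b t‖ + ‖h t‖ ≤ 1 := by
    filter_upwards [hle, coeFn_boundary b] with t h1 h2
    rw [h2] at h1
    linarith
  have h1 : ∀ᵐ t ∂m, ‖(boundary2 b + h) t‖ ≤ 1 := by
    filter_upwards [hbd, Lp.coeFn_add (boundary2 b) h] with t h1 h2
    rw [h2]
    exact (norm_add_le _ _).trans h1
  have h2 : ∀ᵐ t ∂m, ‖(boundary2 b - h) t‖ ≤ 1 := by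
    filter_upwards [hbd, Lp.coeFn_sub (boundary2 b) h] with t h1 h2
    rw [h2]
    exact (norm_sub_le _ _).trans h1
  obtain ⟨B₁, hB₁, hB₁'⟩ := exists_hInf_of_bound (H2.add_mem (boundary2_mem_H2 b) hh) h1
  obtain ⟨B₂, hB₂, hB₂'⟩ := exists_hInf_of_bound (H2.sub_mem (boundary2_mem_H2 b) hh) h2
  -- The boundary functions b + h and b - h average to b, and Taylor coefficients are the Fourier
  -- coefficients of boundary functions, so the identity carries over to the disc.
  have hmid : (1 / 2 : ℝ) • B₁ + (1 / 2 : ℝ) • B₂ = b := by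
    refine Subtype.ext (BoundedContinuousFunction.ext fun z => ?_)
    have hz : ‖(z : ℂ)‖ < 1 := z.norm_lt_one
    have e := ((hasSum_ext B₁ hz).add (hasSum_ext B₂ hz)).mul_left (1 / 2 : ℂ)
    have e' : HasSum (fun n => taylorCoeff b n * (z : ℂ) ^ n)
        ((1 / 2 : ℂ) * (ext (B₁ : 𝔻 →ᵇ ℂ) z + ext (B₂ : 𝔻 →ᵇ ℂ) z)) := by
      convert! e using 2 with n
      rw [← fourierCoeff_boundary2, ← fourierCoeff_boundary2, ← fourierCoeff_boundary2, hB₁', hB₂',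
        ← inner_fourierLp, ← inner_fourierLp, ← inner_fourierLp, inner_add_right, inner_sub_right]
      ring
    have := e'.unique (hasSum_ext b hz)
    rw [ext_of_lt _ hz, ext_of_lt _ hz, ext_of_lt _ hz] at this
    refine Eq.trans ?_ this
    change (1 / 2 : ℝ) • ((B₁ : 𝔻 →ᵇ ℂ) z) + (1 / 2 : ℝ) • ((B₂ : 𝔻 →ᵇ ℂ) z) = _
    rw [Complex.real_smul, Complex.real_smul]
    push_cast
    rw [← mul_add]
    rfl
  have := (mem_extremePoints.1 hb).2 B₁ (mem_closedBall_zero_iff.2 hB₁) B₂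
    (mem_closedBall_zero_iff.2 hB₂)
    ⟨1 / 2, 1 / 2, by norm_num, by norm_num, by norm_num, hmid⟩
  rw [this.1] at hB₁'
  exact left_eq_add.1 hB₁'


/-! ### Uniqueness of Fourier coefficients of integrable functions -/

/-- Integration against r is a continuous functional on C(𝕋) that kills the dense space of
trigonometric polynomials. -/
theorem integral_mul_eq_zero_of_fourier {r : T → ℂ} (hr : Integrable r m)
    (h : ∀ n : ℤ, ∫ t, fourier n t * r t ∂m = 0) (f : C(T, ℂ)) : ∫ t, f t * r t ∂m = 0 := by
  have hint : ∀ f : C(T, ℂ), Integrable (fun t => f t * r t) m := fun f =>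
    hr.bdd_mul f.continuous.aestronglyMeasurable (c := ‖f‖)
      (Eventually.of_forall fun t => f.norm_coe_le_norm t)
  let L : C(T, ℂ) →L[ℂ] ℂ := LinearMap.mkContinuous
    { toFun := fun f => ∫ t, f t * r t ∂m
      map_add' := fun f g => by
        rw [← integral_add (hint f) (hint g)]
        simp only [ContinuousMap.add_apply, add_mul]
      map_smul' := fun c f => by
        rw [RingHom.id_apply, smul_eq_mul, ← integral_const_mul]
        simp only [ContinuousMap.smul_apply, smul_eq_mul, mul_assoc] }
    (∫ t, ‖r t‖ ∂m) fun f => by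
      rw [mul_comm, ← integral_const_mul]
      refine norm_integral_le_of_norm_le (hr.norm.const_mul _) (Eventually.of_forall fun t => ?_)
      rw [norm_mul]
      exact mul_le_mul_of_nonneg_right (f.norm_coe_le_norm t) (norm_nonneg _)
  have hL : L = 0 := by
    refine ContinuousLinearMap.ext_on (s := Set.range (fourier (T := 1))) ?_ ?_
    · rw [Submodule.dense_iff_topologicalClosure_eq_top]
      exact span_fourier_closure_eq_top
    · rintro _ ⟨n, rfl⟩
      exact h n
  exact congrArg (fun M : C(T, ℂ) →L[ℂ] ℂ => M f) hL

/-- A nonnegative integrable function whose nonconstant Fourier coefficients vanish is constant. -/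
theorem ae_eq_const_of_fourier {ρ : T → ℝ} (hρ : Integrable ρ m) (h0 : ∀ t, 0 ≤ ρ t)
    (h : ∀ n : ℤ, n ≠ 0 → ∫ t, fourier n t * (ρ t : ℂ) ∂m = 0) :
    ∀ᵐ t ∂m, ρ t = ∫ s, ρ s ∂m := by
  set c : ℝ := ∫ s, ρ s ∂m with hc
  have hc0 : 0 ≤ c := integral_nonneg h0
  have hr : Integrable (fun t => (ρ t : ℂ) - c) m := hρ.ofReal.sub (integrable_const _)
  have hfour : ∀ n : ℤ, ∫ t, fourier n t * ((ρ t : ℂ) - c) ∂m = 0 := fun n => by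
    have hb : ∀ q : T → ℂ, Integrable q m → Integrable (fun t => fourier n t * q t) m := fun q hq =>
      hq.bdd_mul (fourier n).continuous.aestronglyMeasurable (c := ‖fourier (T := 1) n‖)
        (Eventually.of_forall fun t => (fourier n).norm_coe_le_norm t)
    simp only [mul_sub]
    rw [integral_sub (hb (fun t => (ρ t : ℂ)) hρ.ofReal)
      (hb (fun _ => (c : ℂ)) (integrable_const _))]
    rcases eq_or_ne n 0 with rfl | hn
    · simp only [fourier_zero, one_mul]
      rw [integral_complex_ofReal, ← hc]
      simp
    · rw [h n hn, zero_sub, neg_eq_zero, integral_mul_const]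
      have := fourierCoeff_fourier (T := 1) 0
      have h2 := congrFun this (-n)
      rw [fourierCoeff, Pi.single_eq_of_ne (by simpa using hn)] at h2
      simp only [neg_neg, fourier_zero, smul_eq_mul, mul_one] at h2
      rw [h2, zero_mul]
  -- The finite measures ρ dm and c dm agree on continuous functions, hence coincide; equality of
  -- the densities a.e. follows.
  have key : m.withDensity (fun t => ENNReal.ofReal (ρ t)) =
      m.withDensity (fun _ => ENNReal.ofReal c) := by
    have : IsFiniteMeasure (m.withDensity fun t => ENNReal.ofReal (ρ t)) :=
      isFiniteMeasure_withDensity_ofReal hρ.2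
    have : IsFiniteMeasure (m.withDensity fun _ => ENNReal.ofReal c) :=
      isFiniteMeasure_withDensity_ofReal (integrable_const c).2
    refine ext_of_forall_integral_eq_of_IsFiniteMeasure fun f => ?_
    rw [integral_withDensity_eq_integral_toReal_smul₀ hρ.1.aemeasurable.ennreal_ofReal
      (Eventually.of_forall fun _ => ENNReal.ofReal_lt_top),
      integral_withDensity_eq_integral_toReal_smul₀ (by fun_prop)
      (Eventually.of_forall fun _ => ENNReal.ofReal_lt_top)]
    have hf := integral_mul_eq_zero_of_fourier hr hfour
      ⟨fun t => ((f t : ℝ) : ℂ), by fun_prop⟩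
    have hfi : ∀ q : T → ℝ, Integrable q m → Integrable (fun t => q t * f t) m := fun q hq =>
      hq.mul_bdd f.continuous.aestronglyMeasurable (c := ‖f‖)
        (Eventually.of_forall fun t => f.norm_coe_le_norm t)
    have hf' : ∫ t, (ρ t * f t - c * f t) ∂m = 0 := by
      rw [← Complex.ofReal_eq_zero, ← integral_complex_ofReal]
      refine Eq.trans (integral_congr_ae (Eventually.of_forall fun t => ?_)) hf
      simp only [ContinuousMap.coe_mk]
      push_cast
      ring
    rw [integral_sub (hfi _ hρ) (hfi _ (integrable_const c)), sub_eq_zero] at hf'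
    simpa only [ENNReal.toReal_ofReal (h0 _), ENNReal.toReal_ofReal hc0, smul_eq_mul] using hf'
  have h2 := (withDensity_eq_iff hρ.1.aemeasurable.ennreal_ofReal (by fun_prop)
    (by rw [← ofReal_integral_eq_lintegral_ofReal hρ (Eventually.of_forall h0)]
        exact ENNReal.ofReal_ne_top)).1 key
  filter_upwards [h2] with t ht
  exact (ENNReal.ofReal_eq_ofReal_iff (h0 t) hc0).1 ht

/-! ### Analytic functions of prescribed modulus -/

/-- Multiplication by `ζⁿ` on `L²(𝕋)`. -/
def shift (n : ℕ) : L2 →L[ℂ] L2 := mulOp (fourierLp ∞ (n : ℤ))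

theorem coeFn_shift (n : ℕ) (f : L2) : shift n f =ᵐ[m] fun t => fourier (n : ℤ) t * f t := by
  filter_upwards [coeFn_mulOp (fourierLp ∞ (n : ℤ)) f, coeFn_fourierLp (T := 1) ∞ n] with t h1 h2
  rw [shift, h1, h2]

theorem shift_shift (n k : ℕ) (f : L2) : shift n (shift k f) = shift (n + k) f := by
  refine Lp.ext ?_
  filter_upwards [coeFn_shift n (shift k f), coeFn_shift k f, coeFn_shift (n + k) f] with t h1 h2 h3
  rw [h1, h2, h3, Nat.cast_add, fourier_add, mul_assoc]

theorem coeFn_mono (n : ℕ) : mono n =ᵐ[m] fourier (n : ℤ) := coeFn_fourierLp 2 n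

theorem shift_mono_zero (n : ℕ) : shift n (mono 0) = mono n := by
  refine Lp.ext ?_
  filter_upwards [coeFn_shift n (mono 0), coeFn_mono n, coeFn_mono 0] with t h1 h2 h3
  rw [h1, h2, h3, Nat.cast_zero, fourier_zero, mul_one]

/-- Multiplication by `ζⁿ` on `L²(𝕋) ⊕ L²(𝕋)`. -/
def shift₂ (n : ℕ) : WithLp 2 (L2 × L2) →L[ℂ] WithLp 2 (L2 × L2) :=
  (WithLp.prodContinuousLinearEquiv 2 ℂ L2 L2).symm.toContinuousLinearMap ∘L
    ((shift n ∘L WithLp.fstL 2 ℂ L2 L2).prod (shift n ∘L WithLp.sndL 2 ℂ L2 L2))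

theorem shift₂_fst (n : ℕ) (x : WithLp 2 (L2 × L2)) : (shift₂ n x).fst = shift n x.fst := rfl

theorem shift₂_snd (n : ℕ) (x : WithLp 2 (L2 × L2)) : (shift₂ n x).snd = shift n x.snd := rfl

theorem shift₂_shift₂ (n k : ℕ) (x : WithLp 2 (L2 × L2)) :
    shift₂ n (shift₂ k x) = shift₂ (n + k) x := by
  refine WithLp.ofLp_injective 2 (Prod.ext ?_ ?_)
  · exact shift_shift n k x.fst
  · exact shift_shift n k x.snd

/-- Turns orthogonality of x to its own shifts into vanishing Fourier coefficients of |x.fst|² +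
|x.snd|². -/
theorem inner_shift₂ (n : ℕ) (x : WithLp 2 (L2 × L2)) :
    ⟪x, shift₂ n x⟫_ℂ =
      ∫ t, fourier (n : ℤ) t * ((‖x.fst t‖ ^ 2 + ‖x.snd t‖ ^ 2 : ℝ) : ℂ) ∂m := by
  rw [WithLp.prod_inner_apply]
  change ⟪x.fst, shift n x.fst⟫_ℂ + ⟪x.snd, shift n x.snd⟫_ℂ = _
  rw [L2.inner_def, L2.inner_def, ← integral_add (L2.integrable_inner _ _)
    (L2.integrable_inner _ _)]
  refine integral_congr_ae ?_
  filter_upwards [coeFn_shift n x.fst, coeFn_shift n x.snd] with t h1 h2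
  rw [h1, h2]
  simp only [RCLike.inner_apply]
  push_cast
  rw [← Complex.conj_mul', ← Complex.conj_mul']
  ring

/-- The graph of multiplication by `g`, intersected with `H² ⊕ L²`. -/
def analyticGraph (g : L2) : Submodule ℂ (WithLp 2 (L2 × L2)) :=
  H2.comap (WithLp.fstL 2 ℂ L2 L2).toLinearMap ⊓
    LinearMap.ker (((ContinuousLinearMap.mul ℂ ℂ).holderL m 2 2 1).flip (mono 0) ∘L
        WithLp.sndL 2 ℂ L2 L2 -
      ((ContinuousLinearMap.mul ℂ ℂ).holderL m 2 2 1).flip g ∘L WithLp.fstL 2 ℂ L2 L2).toLinearMap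

/-- The product of x.fst and g is in general only in L¹, so the graph equation is posed there, with
x.snd multiplied by the constant 1 = `mono 0`. Both sides are continuous in x, which makes the graph
closed. -/
theorem mem_analyticGraph {g : L2} {x : WithLp 2 (L2 × L2)} :
    x ∈ analyticGraph g ↔ x.fst ∈ H2 ∧ ∀ᵐ t ∂m, x.snd t = x.fst t * g t := by
  refine and_congr Iff.rfl ?_
  change (ContinuousLinearMap.mul ℂ ℂ).holder 1 x.snd (mono 0) -
    (ContinuousLinearMap.mul ℂ ℂ).holder 1 x.fst g = 0 ↔ _
  rw [sub_eq_zero, Lp.ext_iff]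
  have h1 := (ContinuousLinearMap.mul ℂ ℂ).coeFn_holder (r := 1) x.snd (mono 0)
  have h2 := (ContinuousLinearMap.mul ℂ ℂ).coeFn_holder (r := 1) x.fst g
  refine eventually_congr ?_
  filter_upwards [h1, h2, coeFn_mono 0] with t h1 h2 h3
  rw [h1, h2, h3]
  simp

theorem isClosed_analyticGraph (g : L2) :
    IsClosed (analyticGraph g : Set (WithLp 2 (L2 × L2))) :=
  (isClosed_H2.preimage (WithLp.fstL 2 ℂ L2 L2).continuous).inter
    (ContinuousLinearMap.isClosed_ker _)

theorem shift₂_mem_analyticGraph {g : L2} (n : ℕ) {x : WithLp 2 (L2 × L2)}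
    (hx : x ∈ analyticGraph g) : shift₂ n x ∈ analyticGraph g := by
  rw [mem_analyticGraph] at hx ⊢
  refine ⟨mulOp_mem_H2_of_ae_eq (mono_mem_H2 n) ?_ hx.1, ?_⟩
  · exact (coeFn_fourierLp ∞ n).trans (coeFn_mono n).symm
  · rw [shift₂_fst, shift₂_snd]
    filter_upwards [hx.2, coeFn_shift n x.fst, coeFn_shift n x.snd] with t h1 h2 h3
    rw [h2, h3, h1, mul_assoc]

/-- The component of `(1, g)` orthogonal to all `(ζⁿ, ζⁿ g)`, `n ≥ 1`. -/
theorem exists_mem_analyticGraph_orthogonal (g : L2) :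
    ∃ y ∈ analyticGraph g, ⟪mono 0, y.fst⟫_ℂ = 1 ∧ ∀ n : ℕ, ⟪y, shift₂ (n + 1) y⟫_ℂ = 0 := by
  let x₀ : WithLp 2 (L2 × L2) := WithLp.toLp 2 (mono 0, g)
  have hx₀f : x₀.fst = mono 0 := rfl
  have hx₀s : x₀.snd = g := rfl
  clear_value x₀
  let S : Set (WithLp 2 (L2 × L2)) := Set.range fun n : ℕ => shift₂ (n + 1) x₀
  let N : Submodule ℂ (WithLp 2 (L2 × L2)) := (Submodule.span ℂ S).topologicalClosure
  have hNc : IsClosed (N : Set (WithLp 2 (L2 × L2))) := Submodule.isClosed_topologicalClosure _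
  have : CompleteSpace N := hNc.completeSpace_coe
  have hSN : ∀ n, shift₂ (n + 1) x₀ ∈ N := fun n =>
    Submodule.le_topologicalClosure _ (Submodule.subset_span ⟨n, rfl⟩)
  have hmin : ∀ G : Submodule ℂ (WithLp 2 (L2 × L2)), IsClosed (G : Set (WithLp 2 (L2 × L2))) →
      (∀ n, shift₂ (n + 1) x₀ ∈ G) → N ≤ G := fun G hG h => by
    refine Submodule.topologicalClosure_minimal _ (Submodule.span_le.2 ?_) hG
    rintro _ ⟨n, rfl⟩
    exact h n
  clear_value N
  have hx₀ : x₀ ∈ analyticGraph g := by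
    rw [mem_analyticGraph, hx₀f, hx₀s]
    refine ⟨mono_mem_H2 0, ?_⟩
    filter_upwards [coeFn_mono 0] with t ht
    rw [ht, Nat.cast_zero, fourier_zero, one_mul]
  have hNG : N ≤ analyticGraph g :=
    hmin _ (isClosed_analyticGraph g) fun n => shift₂_mem_analyticGraph _ hx₀
  -- First coordinates in N have zero constant term, so subtracting p keeps the constant term 1 of
  -- x₀; this makes the extremal function nonzero.
  have hN0 : N ≤ (LinearMap.ker (innerSL ℂ (mono 0)).toLinearMap).comap
      (WithLp.fstL 2 ℂ L2 L2).toLinearMap := by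
    refine hmin _ ((ContinuousLinearMap.isClosed_ker _).preimage
      (WithLp.fstL 2 ℂ L2 L2).continuous) fun n => ?_
    change ⟪mono 0, (shift₂ (n + 1) x₀).fst⟫_ℂ = 0
    rw [shift₂_fst, hx₀f, shift_mono_zero, orthonormal_mono.2 (Nat.succ_ne_zero n).symm]
  have hN0' : ∀ x ∈ N, ⟪mono 0, x.fst⟫_ℂ = 0 := fun x hx => hN0 hx
  have hNs : ∀ n, ∀ x ∈ N, shift₂ n x ∈ N := fun n => by
    refine hmin (N.comap (shift₂ n).toLinearMap) (hNc.preimage (shift₂ n).continuous) fun k => ?_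
    rw [Submodule.mem_comap, ContinuousLinearMap.coe_coe, shift₂_shift₂, ← add_assoc]
    exact hSN _
  have hp := N.starProjection_apply_mem x₀
  have hy := N.sub_starProjection_mem_orthogonal x₀
  generalize N.starProjection x₀ = p at hp hy
  refine ⟨x₀ - p, (analyticGraph g).sub_mem hx₀ (hNG hp), ?_, fun n => ?_⟩
  · rw [WithLp.sub_fst, inner_sub_right, hN0' p hp, sub_zero, hx₀f,
      orthonormal_iff_ite.1 orthonormal_mono, if_pos rfl]
  · refine Submodule.inner_left_of_mem_orthogonal ?_ hy
    rw [map_sub]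
    exact N.sub_mem (hSN n) (hNs (n + 1) p hp)

/-- Orthogonality gives the vanishing integrals against ζⁿ for n > 0; conjugation gives n < 0,
because the density is real. -/
theorem ae_eq_const_of_orthogonal_shift₂ {y : WithLp 2 (L2 × L2)}
    (horth : ∀ n : ℕ, ⟪y, shift₂ (n + 1) y⟫_ℂ = 0) :
    ∃ c : ℝ, ∀ᵐ t ∂m, ‖y.fst t‖ ^ 2 + ‖y.snd t‖ ^ 2 = c := by
  have hpos : ∀ n : ℕ,
      ∫ t, fourier ((n + 1 : ℕ) : ℤ) t * ((‖y.fst t‖ ^ 2 + ‖y.snd t‖ ^ 2 : ℝ) : ℂ) ∂m = 0 :=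
    fun n => by rw [← horth n, inner_shift₂]
  have hint : Integrable (fun t => ‖y.fst t‖ ^ 2 + ‖y.snd t‖ ^ 2) m :=
    ((memLp_two_iff_integrable_sq_norm (Lp.aestronglyMeasurable _)).1 (Lp.memLp y.fst)).add
      ((memLp_two_iff_integrable_sq_norm (Lp.aestronglyMeasurable _)).1 (Lp.memLp y.snd))
  have h0 : ∀ t, 0 ≤ ‖y.fst t‖ ^ 2 + ‖y.snd t‖ ^ 2 := fun t => by positivity
  refine ⟨_, ae_eq_const_of_fourier hint h0 fun n hn => ?_⟩
  generalize (fun t => ‖y.fst t‖ ^ 2 + ‖y.snd t‖ ^ 2) = ρ at hpos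
  rcases lt_or_gt_of_ne hn with hn | hn
  · obtain ⟨k, rfl⟩ : ∃ k : ℕ, n = -((k + 1 : ℕ) : ℤ) := ⟨(-n - 1).toNat, by omega⟩
    have h := congrArg (starRingEnd ℂ) (hpos k)
    rw [← integral_conj, map_zero] at h
    simp only [map_mul, Complex.conj_ofReal, ← fourier_neg] at h
    exact h
  · obtain ⟨k, rfl⟩ : ∃ k : ℕ, n = ((k + 1 : ℕ) : ℤ) := ⟨(n - 1).toNat, by omega⟩
    exact hpos k

/-- Szegő's extremal function: for `g ∈ L²(𝕋)` there is `φ ∈ H²` with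
`|φ|² (1 + |g|²)` a positive constant. -/
theorem exists_mem_H2_norm_sq_mul_eq (g : L2) :
    ∃ φ ∈ H2, ∃ c : ℝ, 0 < c ∧ ∀ᵐ t ∂m, ‖φ t‖ ^ 2 * (1 + ‖g t‖ ^ 2) = c := by
  obtain ⟨y, hyG, hy0, horth⟩ := exists_mem_analyticGraph_orthogonal g
  obtain ⟨c, hc⟩ := ae_eq_const_of_orthogonal_shift₂ horth
  rw [mem_analyticGraph] at hyG
  have hc' : ∀ᵐ t ∂m, ‖y.fst t‖ ^ 2 * (1 + ‖g t‖ ^ 2) = c := by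
    filter_upwards [hc, hyG.2] with t h1 h2
    rw [← h1, h2, norm_mul]
    ring
  refine ⟨y.fst, hyG.1, c, ?_, hc'⟩
  -- If c ≤ 0, the first coordinate vanishes a.e., against its constant term 1.
  by_contra hneg
  have : y.fst = 0 := by
    refine Lp.ext ?_
    filter_upwards [hc', Lp.coeFn_zero ℂ 2 m] with t h1 h2
    rw [h2]
    by_contra h3
    have h4 : 0 < ‖y.fst t‖ := norm_pos_iff.2 h3
    have h5 : 0 < ‖y.fst t‖ ^ 2 * (1 + ‖g t‖ ^ 2) := by positivity
    exact hneg (h1 ▸ h5)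
  rw [this, inner_zero_right] at hy0
  exact zero_ne_one hy0

/-! ### Injectivity of `g ↦ P₊(√(1 - |b|²) g)` on `L²(E)` -/

theorem norm_boundary_le_one {b : HInf} (hb : ‖b‖ ≤ 1) : ∀ᵐ t ∂m, ‖boundary b t‖ ≤ 1 := by
  filter_upwards [coeFn_boundary b, boundary2_bound b] with t h1 h2
  rw [h1]
  exact h2.trans hb

theorem norm_le_one_of_extremePoint {b : HInf}
    (hb : b ∈ Set.extremePoints ℝ (Metric.closedBall (0 : HInf) 1)) : ‖b‖ ≤ 1 :=
  mem_closedBall_zero_iff.1 hb.1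

theorem norm_sq_defect {b : HInf} (hb : ‖b‖ ≤ 1) :
    ∀ᵐ t ∂m, ‖defect b t‖ ^ 2 = 1 - ‖boundary b t‖ ^ 2 := by
  filter_upwards [coeFn_defect b, norm_boundary_le_one hb] with t h1 h2
  rw [h1, Complex.norm_real, Real.norm_of_nonneg (Real.sqrt_nonneg _), Real.sq_sqrt]
  nlinarith [norm_nonneg (boundary b t)]

theorem star_defect (b : HInf) : star (defect b) = defect b := by
  refine Lp.ext ?_
  filter_upwards [Lp.coeFn_star (defect b), coeFn_defect b] with t h1 h2
  rw [h1, Pi.star_apply, h2]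
  exact Complex.conj_ofReal _

theorem eq_zero_of_Pplus_mulOp_defect {b : HInf}
    (hb : b ∈ Set.extremePoints ℝ (Metric.closedBall (0 : HInf) 1)) {g : L2}
    (hg : g ∈ L2On (E b)) (h : Pplus (mulOp (defect b) g) = 0) : g = 0 := by
  have hb1 := norm_le_one_of_extremePoint hb
  have hk : star (mulOp (defect b) g) ∈ H2 := star_mem_H2 (Pplus_eq_zero_iff.1 h)
  have hkn : ∀ᵐ t ∂m, ‖(star (mulOp (defect b) g) : L2) t‖ ^ 2 =
      (1 - ‖boundary b t‖ ^ 2) * ‖g t‖ ^ 2 := by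
    filter_upwards [Lp.coeFn_star (mulOp (defect b) g), coeFn_mulOp (defect b) g,
      norm_sq_defect hb1] with t h1 h2 h3
    rw [h1, Pi.star_apply, norm_star, h2, norm_mul, mul_pow, h3]
  generalize (star (mulOp (defect b) g) : L2) = k at hk hkn
  -- The weight 1 + |g|² bounds both φ and φg by √c, so φ is a bounded multiplier that makes φk
  -- bounded.
  obtain ⟨φ, hφ, c, hc, hφc⟩ := exists_mem_H2_norm_sq_mul_eq g
  have hφb : ∀ᵐ t ∂m, ‖φ t‖ ≤ Real.sqrt c := by
    filter_upwards [hφc] with t ht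
    refine Real.le_sqrt_of_sq_le ?_
    rw [← ht]
    nlinarith [mul_nonneg (sq_nonneg ‖φ t‖) (sq_nonneg ‖g t‖)]
  obtain ⟨Φ, hΦ⟩ := exists_LInf_of_ae_bound hφb
  have hq : mulOp Φ k ∈ H2 := mulOp_mem_H2_of_ae_eq hφ hΦ hk
  have hqn : ∀ᵐ t ∂m, ‖mulOp Φ k t‖ ^ 2 = ‖φ t‖ ^ 2 * ((1 - ‖boundary b t‖ ^ 2) * ‖g t‖ ^ 2) := by
    filter_upwards [coeFn_mulOp Φ k, hΦ, hkn] with t h1 h2 h3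
    rw [h1, norm_mul, mul_pow, h2, h3]
  generalize mulOp Φ k = q at hq hqn
  have hqle : ∀ᵐ t ∂m, ‖q t‖ ^ 2 ≤ c * (1 - ‖boundary b t‖ ^ 2) := by
    filter_upwards [hqn, hφc, norm_boundary_le_one hb1] with t h1 h2 h3
    have h4 : 0 ≤ 1 - ‖boundary b t‖ ^ 2 := by nlinarith [norm_nonneg (boundary b t)]
    rw [h1, ← h2]
    nlinarith [mul_nonneg (sq_nonneg ‖φ t‖) h4]
  have hqb : ∀ᵐ t ∂m, ‖q t‖ ≤ Real.sqrt c := by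
    filter_upwards [hqle] with t ht
    refine Real.le_sqrt_of_sq_le (ht.trans ?_)
    nlinarith [mul_nonneg hc.le (sq_nonneg ‖boundary b t‖)]
  obtain ⟨Q, hQ⟩ := exists_LInf_of_ae_bound hqb
  have hsq : ∀ᵐ t ∂m, ‖(((1 / (2 * c) : ℝ) : ℂ) • mulOp Q q) t‖ = ‖q t‖ ^ 2 / (2 * c) := by
    filter_upwards [Lp.coeFn_smul ((1 / (2 * c) : ℝ) : ℂ) (mulOp Q q), coeFn_mulOp Q q, hQ]
      with t h1 h2 h3
    rw [h1, Pi.smul_apply, h2, h3, norm_smul, norm_mul, Complex.norm_real,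
      Real.norm_of_nonneg (by positivity)]
    ring
  -- The bound on q is of order √(1 - |b|), so it is q² that compares with 1 - |b|. The factor 2c
  -- comes from 1 - |b|² ≤ 2(1 - |b|), which is (1 - |b|)² ≥ 0.
  have hzero := eq_zero_of_extremePoint hb
    (H2.smul_mem ((1 / (2 * c) : ℝ) : ℂ) (mulOp_mem_H2_of_ae_eq hq hQ hq)) (by
      filter_upwards [hsq, hqle, norm_boundary_le_one hb1] with t h1 h2 h3
      rw [h1, div_le_iff₀ (by positivity)]
      refine h2.trans ?_
      nlinarith [mul_nonneg hc.le (sq_nonneg (1 - ‖boundary b t‖))])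
  rw [hzero] at hsq
  refine Lp.ext ?_
  filter_upwards [hsq, hqn, hφc, hg, Lp.coeFn_zero ℂ 2 m] with t h1 h2 h3 h4 h5
  rw [h5] at h1 ⊢
  by_contra hgt
  -- Where g ≠ 0, the point lies in E, so |b| < 1; φ ≠ 0 since c > 0. Hence |q|² = |φ|²(1 -
  -- |b|²)|g|² > 0, contrary to q² = 0.
  have hE : t ∈ E b := by
    by_contra hE
    exact hgt (h4 hE)
  have hE' : ‖boundary b t‖ < 1 := hE
  have hg0 : 0 < ‖g t‖ := norm_pos_iff.2 hgt
  have hφ0 : 0 < ‖φ t‖ ^ 2 := by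
    refine (sq_nonneg _).lt_of_ne' fun h0 => ?_
    rw [h0, zero_mul] at h3
    exact hc.ne h3
  have hd : 0 < 1 - ‖boundary b t‖ ^ 2 := by nlinarith [norm_nonneg (boundary b t)]
  have hq0 : 0 < ‖q t‖ ^ 2 / (2 * c) := by
    rw [h2]
    positivity
  rw [← h1, Pi.zero_apply, norm_zero] at hq0
  exact lt_irrefl _ hq0

/-! ### The complement of the space of pairs `(bh, √(1 - |b|²) h)` -/

theorem isClosed_L2On (S : Set T) : IsClosed (L2On S : Set L2) := by
  refine isSeqClosed_iff_isClosed.1 fun x f hx hlim => ?_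
  obtain ⟨ns, -, hns⟩ := (tendstoInMeasure_of_tendsto_Lp hlim).exists_seq_tendsto_ae
  have hall : ∀ᵐ t ∂m, ∀ n, t ∉ S → x n t = 0 := ae_all_iff.2 hx
  change ∀ᵐ t ∂m, t ∉ S → f t = 0
  filter_upwards [hns, hall] with t h1 h2 ht
  refine tendsto_nhds_unique h1 ?_
  simp only [h2 _ ht]
  exact tendsto_const_nhds

instance (S : Set T) : CompleteSpace (L2On S) := (isClosed_L2On S).completeSpace_coe

theorem mulOp_boundary_mem_H2 (b : HInf) (h : H2) : mulOp (boundary b) (h : L2) ∈ H2 :=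
  mulOp_mem_H2_of_ae_eq (boundary2_mem_H2 b) (coeFn_boundary b) h.2

theorem mulOp_defect_mem_L2On (b : HInf) (f : L2) : mulOp (defect b) f ∈ L2On (E b) := by
  change ∀ᵐ t ∂m, t ∉ E b → mulOp (defect b) f t = 0
  filter_upwards [coeFn_mulOp (defect b) f, coeFn_defect b] with t h1 h2 ht
  have h3 : 1 ≤ ‖boundary b t‖ := not_lt.1 ht
  rw [h1, h2, Real.sqrt_eq_zero_of_nonpos (by nlinarith), Complex.ofReal_zero, zero_mul]

theorem norm_sq_mulOp_add {b : HInf} (hb : ‖b‖ ≤ 1) (f : L2) :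
    ‖mulOp (boundary b) f‖ ^ 2 + ‖mulOp (defect b) f‖ ^ 2 = ‖f‖ ^ 2 := by
  have h : ⟪mulOp (boundary b) f, mulOp (boundary b) f⟫_ℂ +
      ⟪mulOp (defect b) f, mulOp (defect b) f⟫_ℂ = ⟪f, f⟫_ℂ := by
    rw [L2.inner_def, L2.inner_def, L2.inner_def, ← integral_add (L2.integrable_inner _ _)
      (L2.integrable_inner _ _)]
    refine integral_congr_ae ?_
    filter_upwards [coeFn_mulOp (boundary b) f, coeFn_mulOp (defect b) f, norm_sq_defect hb]
      with t h1 h2 h3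
    rw [h1, h2, inner_self_eq_norm_sq_to_K, inner_self_eq_norm_sq_to_K,
      inner_self_eq_norm_sq_to_K, norm_mul, norm_mul]
    norm_cast
    rw [mul_pow, mul_pow, h3]
    ring
  rw [inner_self_eq_norm_sq_to_K, inner_self_eq_norm_sq_to_K, inner_self_eq_norm_sq_to_K] at h
  exact_mod_cast h

theorem toeplitz_boundary_apply (b : HInf) (h : H2) :
    toeplitz (boundary b) h = (⟨mulOp (boundary b) h, mulOp_boundary_mem_H2 b h⟩ : H2) :=
  H2.orthogonalProjectionOnto_mem_subspace_eq_self ⟨_, mulOp_boundary_mem_H2 b h⟩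

/-- Multiplication by `√(1 - |b|²)` from `H²` to `L²(E)`. -/
def defectOp (b : HInf) : H2 →L[ℂ] L2On (E b) :=
  (mulOp (defect b) ∘L H2.subtypeL).codRestrict (L2On (E b)) fun h => mulOp_defect_mem_L2On b h

/-- Multiplication by the real function √(1 - |b|²) is self-adjoint on L²(𝕋), and the adjoint of the
inclusion of H² is P₊. -/
theorem adjoint_defectOp_apply (b : HInf) (g : L2On (E b)) :
    (defectOp b).adjoint g = Pplus (mulOp (defect b) (g : L2)) := by
  refine ext_inner_left ℂ fun h => ?_
  rw [ContinuousLinearMap.adjoint_inner_right]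
  change ⟪mulOp (defect b) (h : L2), (g : L2)⟫_ℂ = _
  rw [inner_mulOp, star_defect, Pplus, ← Submodule.adjoint_subtypeL,
    ContinuousLinearMap.adjoint_inner_right]
  rfl

theorem adjoint_toeplitz_boundary_apply (b : HInf) (f : H2) :
    (toeplitz (boundary b)).adjoint f = Pplus (mulOp (star (boundary b)) (f : L2)) := by
  rw [adjoint_toeplitz]
  rfl

/-- Because b is analytic, P₊ loses nothing of bh, and the pointwise identity |b|² + (1 - |b|²) = 1
integrates. -/
theorem norm_sq_toeplitz_add {b : HInf} (hb : ‖b‖ ≤ 1) (h : H2) :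
    ‖toeplitz (boundary b) h‖ ^ 2 + ‖defectOp b h‖ ^ 2 = ‖h‖ ^ 2 := by
  rw [toeplitz_boundary_apply]
  exact norm_sq_mulOp_add hb h

theorem adjoint_defectOp_injective {b : HInf}
    (hb : b ∈ Set.extremePoints ℝ (Metric.closedBall (0 : HInf) 1)) :
    Function.Injective (defectOp b).adjoint := by
  refine (injective_iff_map_eq_zero _).2 fun g hg => ?_
  rw [adjoint_defectOp_apply] at hg
  exact Subtype.ext (eq_zero_of_Pplus_mulOp_defect hb g.2 hg)

end DBR

end

/-! ### The proposition for an extreme point b -/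

theorem mainTheorem2 (b : DBR.HInf)
    (hb : b ∈ Set.extremePoints ℝ (Metric.closedBall (0 : DBR.HInf) 1)) :
    (∀ f : DBR.Hb b, ∃! g : DBR.L2On (DBR.E b),
      DBR.Pplus (DBR.mulOp (star (DBR.boundary b)) (DBR.Hb.incl b f : DBR.L2)) =
        -DBR.Pplus (DBR.mulOp (DBR.defect b) (g : DBR.L2))) ∧
    ∃ J : DBR.Hb b →ₗᵢ[ℂ] WithLp 2 (DBR.H2 × DBR.L2On (DBR.E b)),
      (∀ f : DBR.Hb b, (J f).fst = DBR.Hb.incl b f ∧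
        DBR.Pplus (DBR.mulOp (star (DBR.boundary b)) (DBR.Hb.incl b f : DBR.L2)) =
          -DBR.Pplus (DBR.mulOp (DBR.defect b) ((J f).snd : DBR.L2))) ∧
      (fun p : WithLp 2 (DBR.H2 × DBR.L2On (DBR.E b)) => ((p.fst : DBR.L2), (p.snd : DBR.L2))) ''
          ((LinearMap.range J.toLinearMap)ᗮ : Submodule ℂ _) =
        Set.range fun h : DBR.H2 =>
          (DBR.mulOp (DBR.boundary b) (h : DBR.L2), DBR.mulOp (DBR.defect b) (h : DBR.L2)) := by
  have hb1 := DBR.norm_le_one_of_extremePoint hb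
  have hinj := DBR.adjoint_defectOp_injective hb
  obtain ⟨J, hJ, hrange⟩ := DBR.exists_linearIsometry_rangeSpace_sqrtOp
    (DBR.norm_sq_toeplitz_add hb1) hinj (A := DBR.A b) (by rw [DBR.adjoint_toeplitz]; rfl)
  have hsol : ∀ f : DBR.Hb b,
      DBR.Pplus (DBR.mulOp (star (DBR.boundary b)) (DBR.Hb.incl b f : DBR.L2)) =
        -DBR.Pplus (DBR.mulOp (DBR.defect b) ((J f).snd : DBR.L2)) := fun f => by
    rw [← DBR.adjoint_toeplitz_boundary_apply, ← DBR.adjoint_defectOp_apply]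
    exact (hJ f).2
  -- The solution g is the second coordinate of J f; two solutions have the same image under the
  -- injective adjoint of `defectOp`.
  refine ⟨fun f => ⟨(J f).snd, hsol f, fun g hg => hinj ?_⟩, J, fun f => ⟨(hJ f).1, hsol f⟩, ?_⟩
  · rw [DBR.adjoint_defectOp_apply, DBR.adjoint_defectOp_apply]
    exact neg_inj.1 (hg.symm.trans (hsol f))
  · ext p
    constructor
    · rintro ⟨y, hy, rfl⟩
      obtain ⟨h, rfl⟩ := (hrange y).1 hy
      refine ⟨h, ?_⟩
      rw [DBR.toeplitz_boundary_apply]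
      rfl
    · rintro ⟨h, rfl⟩
      refine ⟨_, (hrange _).2 ⟨h, rfl⟩, ?_⟩
      rw [DBR.toeplitz_boundary_apply]
      rfl
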